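/- **Setting.** Let $m>n\ge 0$, let $\mathcal X\subseteq\mathbb R^m$, and let $\rho:\mathbb R^m\to[0,\infty)$ be a bounded probability density that is positive on $\mathcal X$ and zero off $\mathcal X$; $\mathbb E$ denotes expectation for $x\sim\rho$ and, where present, over the Monte Carlo draws below. Let $f$ be measurable, absolutely continuous on every line segment contained in $\mathcal X$, differentiable at $\rho$-almost every point, square-integrable with respect to $\rho$, and such that the products of its partial derivatives are $\rho$-integrable. Put $C=\mathbb E[(\nabla f)(\nabla f)^T]=W\Lambda W^T$ with $W$ orthogonal, $\Lambda=\mathrm{diag}(\lambda_1,\dots,\lambda_m)$, $\lambda_1\ge\dots\ge\lambda_m\,(\ge 0)$. **Constant $C_1$.** Let $C_1=C_1(\mathcal X,\rho)$ be the Poincaré constant of $(\mathcal X,\rho)$: the least $C\in[0,\infty]$ such that, for every $k$ and every linear isometry $V:\mathbb R^k\to\mathbb R^m$, for $\rho$-almost every $x$ the probability density $z\mapsto \rho(x+Vz)/\int\rho(x+Vz')\,dz'$ on $\mathbb R^k$ satisfies $\mathrm{Var}(u)\le C\,\mathbb E\|\nabla u\|^2$ for all $u$ in the same class (on the slice $\{z: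 x+Vz\in\mathcal X\}$) as $f$. Assume that $\mathcal X,\rho$ admit a Poincaré inequality, i.e. $C_1<\infty$. **Perturbed directions.** Let $\tilde W=[\tilde W_1\ \tilde W_2]$ be orthogonal, $\tilde W_1$ having $n$ columns, with the sign of each column $\tilde w_i$ chosen to minimize $\|w_i-\tilde w_i\|$, and $\|W-\tilde W\|_2\le\varepsilon$, $\varepsilon>0$. Put $\tilde y=\tilde W_1^Tx$, $\tilde z=\tilde W_2^Tx$, with the joint density $\tilde\pi(\tilde y,\tilde z)=\rho(\tilde W_1\tilde y+\tilde W_2\tilde z)$ and the marginal and conditional densities it defines. **Approximations.** For $N\ge1$ let $$\hat G_\varepsilon(\tilde y)=\frac1N\sum_{i=1}^N f(\tilde W_1\tilde y+\tilde W_2\tilde z_i),\qquad \tilde z_1,\dots,\tilde z_N\ \text{i.i.d. from}\ \tilde\pi_{\tilde Z|\tilde Y}(\cdot|\tilde y),$$ where separate evaluations of $\hat G_\varepsilon$ use independent draws, and let $\hat F_\varepsilon(x)=\hat G_\varepsilon(\tilde W_1^Tx)$. Given design points $\tilde y_1,\dots,\tilde y_P$ at which the conditional density is defined ($0<\tilde\pi_{\tilde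 Y}(\tilde y_k)<\infty$) and a measurable response surface method $\mathcal R$, let $\tilde G_\varepsilon(\tilde y)=\mathcal R(\tilde y;\hat G_{\varepsilon}(\tilde y_1),\dots,\hat G_{\varepsilon}(\tilde y_P))$ and $\tilde F_\varepsilon(x)=\tilde G_\varepsilon(\tilde W_1^Tx)$. **Response-surface assumption.** $C_2,\delta\ge0$ satisfy $$\mathbb E\big[(\hat F_\varepsilon-\tilde F_\varepsilon)^2\,\big|\,\tilde z\big]\le C_2\,\delta\qquad\text{for almost every }\tilde z,$$ where the conditional expectation averages over $\tilde y\sim\tilde\pi_{\tilde Y|\tilde Z}(\cdot|\tilde z)$ and over all Monte Carlo draws. **Theorem.** Then $(f-\tilde F_\varepsilon)^2$ is integrable and $$\mathbb E\big[(f-\tilde F_\varepsilon)^2\big]\le C_1\Big(1+\frac1N\Big)\Big(\varepsilon(\lambda_1+\dots+\lambda_n)^{1/2}+(\lambda_{n+1}+\dots+\lambda_m)^{1/2}\Big)^2+C_2\,\delta .$$ -/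

import Mathlib

open MeasureTheory
open scoped ENNReal

noncomputable section

/-- `𝔼 k` is `ℝ^k` with the Euclidean norm and Lebesgue measure. -/
abbrev 𝔼 (k : ℕ) : Type := EuclideanSpace ℝ (Fin k)

/-- `ρ` is a bounded probability density on `ℝ^m`, positive exactly on `X`. -/
structure IsInputDensity {m : ℕ} (X : Set (𝔼 m)) (ρ : 𝔼 m → ℝ) : Prop where
  measurable : Measurable ρ
  bounded : ∃ B : ℝ, ∀ x, ρ x ≤ B
  pos : ∀ x ∈ X, 0 < ρ x
  zero : ∀ x ∉ X, ρ x = 0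
  mass_one : ∫⁻ x, ENNReal.ofReal (ρ x) = 1

/-- The probability measure `ρ(x) dx`. -/
def inputMeasure {m : ℕ} (ρ : 𝔼 m → ℝ) : Measure (𝔼 m) :=
  volume.withDensity fun x => ENNReal.ofReal (ρ x)

/-- The probability measure on `ℝ^k` with density `g / ∫ g`
(meaningful when `0 < ∫ g < ∞`). -/
def normalizedDensity {k : ℕ} (g : 𝔼 k → ℝ) : Measure (𝔼 k) :=
  (∫⁻ z, ENNReal.ofReal (g z))⁻¹ • volume.withDensity fun z => ENNReal.ofReal (g z)

/-- The class of functions under consideration on a domain `X ⊆ ℝ^k` carrying a measure `μ`: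
absolutely continuous on every line segment contained in `X`, differentiable at `μ`-almost every
point, square integrable, and such that all products of two partial derivatives are integrable
(equivalently, the gradient is square integrable). -/
structure IsAdmissible {k : ℕ} (X : Set (𝔼 k)) (μ : Measure (𝔼 k)) (f : 𝔼 k → ℝ) : Prop where
  measurable : Measurable f
  absCont : ∀ a b : 𝔼 k, segment ℝ a b ⊆ X →
    AbsolutelyContinuousOnInterval (fun t : ℝ => f (AffineMap.lineMap a b t)) 0 1
  differentiable : ∀ᵐ x ∂μ, DifferentiableAt ℝ f x
  sq_integrable : MemLp f 2 μ
  grad_sq_integrable : MemLp (fun x => gradient f x) 2 μ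

/-- The Poincaré constant of `(X, ρ)`: the smallest `C ∈ [0, ∞]` such that the conditional
densities of `ρ` on affine slices `x + V(ℝ^k)` of `X` (`V` a linear isometry, of any dimension
`k`, and almost every `x`) satisfy the Poincaré inequality `Var(u) ≤ C · E ‖∇u‖²`. -/
def poincareConst {m : ℕ} (X : Set (𝔼 m)) (ρ : 𝔼 m → ℝ) : ℝ≥0∞ :=
  sInf {C : ℝ≥0∞ | ∀ (k : ℕ) (V : 𝔼 k →ₗᵢ[ℝ] 𝔼 m), ∀ᵐ x ∂(inputMeasure ρ), ∀ u : 𝔼 k → ℝ,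
    IsAdmissible {z | x + V z ∈ X} (normalizedDensity fun z => ρ (x + V z)) u →
    ProbabilityTheory.evariance u (normalizedDensity fun z => ρ (x + V z)) ≤
      C * ∫⁻ z, ‖gradient u z‖ₑ ^ 2 ∂(normalizedDensity fun z => ρ (x + V z))}

/-- The matrix `C = E[(∇f)(∇f)ᵀ]`. -/
def gradMatrix {m : ℕ} (ρ : 𝔼 m → ℝ) (f : 𝔼 m → ℝ) : Matrix (Fin m) (Fin m) ℝ :=
  Matrix.of fun i j => ∫ x, (gradient f x) i * (gradient f x) j ∂(inputMeasure ρ)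

/-- `C = W Λ Wᵀ` with `W` orthogonal and `Λ = diag(lam)`, `lam` in decreasing order. -/
structure IsEigendecomposition {m : ℕ} (C W : Matrix (Fin m) (Fin m) ℝ) (lam : Fin m → ℝ) :
    Prop where
  orthogonal : W ∈ Matrix.orthogonalGroup (Fin m) ℝ
  antitone : Antitone lam
  eq : C = W * Matrix.diagonal lam * W.transpose

/-- `W'` is an orthogonal perturbation of `W`, with column signs chosen to minimize the column
distances, and `‖W - W'‖ ≤ ε` in the matrix 2-norm. -/
structure IsPerturbation {m : ℕ} (W W' : Matrix (Fin m) (Fin m) ℝ) (ε : ℝ) : Prop where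
  orthogonal : W' ∈ Matrix.orthogonalGroup (Fin m) ℝ
  sign : ∀ i, ‖(WithLp.toLp 2 (W.col i - W'.col i) : 𝔼 m)‖ ≤
    ‖(WithLp.toLp 2 (W.col i + W'.col i) : 𝔼 m)‖
  pos : 0 < ε
  dist_le : ‖Matrix.toEuclideanCLM (n := Fin m) (𝕜 := ℝ) (W - W')‖ ≤ ε

section Coordinates

variable {n l : ℕ}

/-- The first `n` columns `W₁` of `W`. -/
def headCols (W : Matrix (Fin (n + l)) (Fin (n + l)) ℝ) : Matrix (Fin (n + l)) (Fin n) ℝ :=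
  W.submatrix id (Fin.castAdd l)

/-- The last `l` columns `W₂` of `W`. -/
def tailCols (W : Matrix (Fin (n + l)) (Fin (n + l)) ℝ) : Matrix (Fin (n + l)) (Fin l) ℝ :=
  W.submatrix id (Fin.natAdd n)

/-- The coordinates `y = W₁ᵀ x`. -/
def coordY (W : Matrix (Fin (n + l)) (Fin (n + l)) ℝ) (x : 𝔼 (n + l)) : 𝔼 n :=
  Matrix.toEuclideanLin (headCols W).transpose x

/-- The coordinates `z = W₂ᵀ x`. -/
def coordZ (W : Matrix (Fin (n + l)) (Fin (n + l)) ℝ) (x : 𝔼 (n + l)) : 𝔼 l :=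
  Matrix.toEuclideanLin (tailCols W).transpose x

/-- The point `W₁ y + W₂ z`. -/
def combine (W : Matrix (Fin (n + l)) (Fin (n + l)) ℝ) (y : 𝔼 n) (z : 𝔼 l) : 𝔼 (n + l) :=
  Matrix.toEuclideanLin (headCols W) y + Matrix.toEuclideanLin (tailCols W) z

/-- The marginal density `π_Y(y) = ∫ ρ(W₁ y + W₂ z) dz`. -/
def marginalY (ρ : 𝔼 (n + l) → ℝ) (W : Matrix (Fin (n + l)) (Fin (n + l)) ℝ) (y : 𝔼 n) : ℝ≥0∞ :=
  ∫⁻ z : 𝔼 l, ENNReal.ofReal (ρ (combine W y z))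

/-- The conditional law of `z` given `y`, with density `π_{Z|Y}(z|y)`. -/
def condZ (ρ : 𝔼 (n + l) → ℝ) (W : Matrix (Fin (n + l)) (Fin (n + l)) ℝ) (y : 𝔼 n) :
    Measure (𝔼 l) :=
  normalizedDensity fun z => ρ (combine W y z)

/-- The conditional law of `y` given `z`, with density `π_{Y|Z}(y|z)`. -/
def condY (ρ : 𝔼 (n + l) → ℝ) (W : Matrix (Fin (n + l)) (Fin (n + l)) ℝ) (z : 𝔼 l) :
    Measure (𝔼 n) :=
  normalizedDensity fun y => ρ (combine W y z)

/-- The Monte Carlo estimate `Ĝ(y) = (1/N) ∑ᵢ f(W₁ y + W₂ zᵢ)`. -/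
def mcEstimate (f : 𝔼 (n + l) → ℝ) (W : Matrix (Fin (n + l)) (Fin (n + l)) ℝ) {N : ℕ}
    (y : 𝔼 n) (z : Fin N → 𝔼 l) : ℝ :=
  (1 / (N : ℝ)) * ∑ i, f (combine W y (z i))

/-- The law of `N` independent draws from the conditional law of `z` given `y`. -/
def sampleLaw (ρ : 𝔼 (n + l) → ℝ) (W : Matrix (Fin (n + l)) (Fin (n + l)) ℝ) (N : ℕ) (y : 𝔼 n) :
    Measure (Fin N → 𝔼 l) :=
  Measure.pi fun _ => condZ ρ W y

/-- The law of the draws used for the training data: independent samples at the design points. -/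
def designLaw (ρ : 𝔼 (n + l) → ℝ) (W : Matrix (Fin (n + l)) (Fin (n + l)) ℝ) (N : ℕ) {P : ℕ}
    (design : Fin P → 𝔼 n) : Measure (Fin P → Fin N → 𝔼 l) :=
  Measure.pi fun k => sampleLaw ρ W N (design k)

/-- The response surface `G̃(y) = R(y; Ĝ₁, …, Ĝ_P)`, where `Ĝ_k` is the Monte Carlo estimate at
the `k`th design point computed from the draws `d k`. -/
def responseSurface (f : 𝔼 (n + l) → ℝ) (W : Matrix (Fin (n + l)) (Fin (n + l)) ℝ) {N P : ℕ}
    (design : Fin P → 𝔼 n) (R : 𝔼 n → (Fin P → ℝ) → ℝ) (d : Fin P → Fin N → 𝔼 l) (y : 𝔼 n) : ℝ :=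
  R y fun k => mcEstimate f W (design k) (d k)

/-- The bound `E[(F̂ - F̃)² | z] ≤ b` for (almost) all `z`. The conditional expectation averages
over `y` given `z`, over the training draws `d`, and over the independent draws `ζ` which enter
`F̂ = Ĝ(y)`. -/
def ResponseSurfaceBound (f ρ : 𝔼 (n + l) → ℝ) (W : Matrix (Fin (n + l)) (Fin (n + l)) ℝ)
    (N : ℕ) {P : ℕ} (design : Fin P → 𝔼 n) (R : 𝔼 n → (Fin P → ℝ) → ℝ) (b : ℝ) : Prop :=
  ∀ᵐ z ∂((inputMeasure ρ).map (coordZ W)),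
    ∫⁻ y, ∫⁻ d, ∫⁻ ζ, ENNReal.ofReal ((mcEstimate f W y ζ - responseSurface f W design R d y) ^ 2)
      ∂(sampleLaw ρ W N y) ∂(designLaw ρ W N design) ∂(condY ρ W z) ≤ ENNReal.ofReal b

end Coordinates

end

/-! ### Orthogonal coordinates (y, z) on ℝ^(n+l). -/

section CoordinateGeometry

open Matrix

variable {n l : ℕ} {W : Matrix (Fin (n + l)) (Fin (n + l)) ℝ}

/-! Fix y and the training draws d. The response surface is then a constant c along the fibre over
y, so the conditional second moment of f about c is exactly Var(f | y) + (E[f | y] - c)². Averaging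
over y and d gives `lintegral_error_eq`, an identity with no cross term, and the two terms are
bounded separately.

Variance: the Poincaré inequality on slices in the directions W̃₂ gives C₁ E‖W̃₂ᵀ∇f‖²
(`lintegral_evariance_condZ_le`). Diagonalising C turns this expectation into ∑ λᵢ ‖W̃₂ᵀwᵢ‖². For i
≤ n, W̃₂ᵀw̃ᵢ = 0, so the factor is ‖W̃₂ᵀ(wᵢ - w̃ᵢ)‖² ≤ ε²; for i > n it is at most 1
(`integral_norm_sq_coordZ_gradient_le`).

Bias: the Monte Carlo estimate at y is unbiased for E[f | y], so (E[f | y] - c)² is at most its mean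
squared distance to c, which the response-surface assumption controls (`lintegral_bias_le`).

The true conditional mean serves as intermediary instead of its Monte Carlo estimate, so the
argument yields the constant C₁; the factor 1 + 1/N is slack. -/

lemma headCols_transpose_mul_headCols (hW : W ∈ Matrix.orthogonalGroup (Fin (n + l)) ℝ) :
    (headCols W)ᵀ * headCols W = 1 := by
  have h := (Matrix.mem_orthogonalGroup_iff' (Fin (n + l)) ℝ).1 hW
  ext i j
  have := congrFun (congrFun h (Fin.castAdd l i)) (Fin.castAdd l j)
  simpa [Matrix.mul_apply, headCols, Matrix.one_apply, star_eq_conjTranspose] using this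

lemma tailCols_transpose_mul_tailCols (hW : W ∈ Matrix.orthogonalGroup (Fin (n + l)) ℝ) :
    (tailCols W)ᵀ * tailCols W = 1 := by
  have h := (Matrix.mem_orthogonalGroup_iff' (Fin (n + l)) ℝ).1 hW
  ext i j
  have := congrFun (congrFun h (Fin.natAdd n i)) (Fin.natAdd n j)
  simpa [Matrix.mul_apply, tailCols, Matrix.one_apply, star_eq_conjTranspose] using this

lemma headCols_transpose_mul_tailCols (hW : W ∈ Matrix.orthogonalGroup (Fin (n + l)) ℝ) :
    (headCols W)ᵀ * tailCols W = 0 := by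
  have h := (Matrix.mem_orthogonalGroup_iff' (Fin (n + l)) ℝ).1 hW
  ext i j
  have h1 := congrFun (congrFun h (Fin.castAdd l i)) (Fin.natAdd n j)
  have hne : Fin.castAdd l i ≠ Fin.natAdd n j := by
    intro h
    have h2 := congrArg Fin.val h
    simp at h2
    omega
  simpa [Matrix.mul_apply, headCols, tailCols, Matrix.one_apply, star_eq_conjTranspose, hne]
    using h1

lemma tailCols_transpose_mul_headCols (hW : W ∈ Matrix.orthogonalGroup (Fin (n + l)) ℝ) :
    (tailCols W)ᵀ * headCols W = 0 := by
  have h := congrArg Matrix.transpose (headCols_transpose_mul_tailCols hW)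
  simpa [Matrix.transpose_mul] using h

lemma headCols_add_tailCols (hW : W ∈ Matrix.orthogonalGroup (Fin (n + l)) ℝ) :
    headCols W * (headCols W)ᵀ + tailCols W * (tailCols W)ᵀ = 1 := by
  rw [← (Matrix.mem_orthogonalGroup_iff (Fin (n + l)) ℝ).1 hW]
  ext i j
  simp [Matrix.mul_apply, headCols, tailCols, Fin.sum_univ_add]

lemma coordY_combine (hW : W ∈ Matrix.orthogonalGroup (Fin (n + l)) ℝ) (y : 𝔼 n) (z : 𝔼 l) :
    coordY W (combine W y z) = y := by
  ext1
  simp [coordY, combine, Matrix.toLpLin_apply, Matrix.mulVec_add, Matrix.mulVec_mulVec,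
    headCols_transpose_mul_headCols hW, headCols_transpose_mul_tailCols hW]

lemma coordZ_combine (hW : W ∈ Matrix.orthogonalGroup (Fin (n + l)) ℝ) (y : 𝔼 n) (z : 𝔼 l) :
    coordZ W (combine W y z) = z := by
  ext1
  simp [coordZ, combine, Matrix.toLpLin_apply, Matrix.mulVec_add, Matrix.mulVec_mulVec,
    tailCols_transpose_mul_headCols hW, tailCols_transpose_mul_tailCols hW]

lemma combine_coord (hW : W ∈ Matrix.orthogonalGroup (Fin (n + l)) ℝ) (x : 𝔼 (n + l)) :
    combine W (coordY W x) (coordZ W x) = x := by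
  ext i
  simp only [coordZ, coordY, combine, Matrix.toLpLin_apply, Matrix.mulVec_mulVec, PiLp.add_apply]
  rw [← Pi.add_apply, ← Matrix.add_mulVec, headCols_add_tailCols hW, Matrix.one_mulVec]

/-- The blocks of columns are orthonormal and mutually orthogonal, so the cross terms vanish. Volume
preservation, the slice isometry and the contraction property of `coordZ` all rest on this. -/
lemma norm_sq_combine (hW : W ∈ Matrix.orthogonalGroup (Fin (n + l)) ℝ) (y : 𝔼 n) (z : 𝔼 l) :
    ‖combine W y z‖ ^ 2 = ‖y‖ ^ 2 + ‖z‖ ^ 2 := by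
  have key : ∀ {k : ℕ} (v : 𝔼 k), ‖v‖ ^ 2 = v.ofLp ⬝ᵥ v.ofLp := fun v => by
    rw [EuclideanSpace.norm_sq_eq]
    simp [dotProduct, sq]
  rw [key, key, key]
  simp only [combine, Matrix.toLpLin_apply, WithLp.ofLp_add, add_dotProduct, dotProduct_add]
  rw [Matrix.dotProduct_mulVec, Matrix.dotProduct_mulVec, Matrix.dotProduct_mulVec,
    Matrix.dotProduct_mulVec, ← Matrix.mulVec_transpose, ← Matrix.mulVec_transpose,
    ← Matrix.mulVec_transpose, ← Matrix.mulVec_transpose]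
  simp [Matrix.mulVec_mulVec, headCols_transpose_mul_headCols hW,
    headCols_transpose_mul_tailCols hW, tailCols_transpose_mul_headCols hW,
    tailCols_transpose_mul_tailCols hW]

/-- The coordinates `(y, z)` as a linear isometry onto the whole space. -/
noncomputable def combineIsometry (hW : W ∈ Matrix.orthogonalGroup (Fin (n + l)) ℝ) :
    WithLp 2 (𝔼 n × 𝔼 l) ≃ₗᵢ[ℝ] 𝔼 (n + l) :=
  LinearIsometryEquiv.mk
    { toFun := fun p => combine W p.fst p.snd
      invFun := fun x => WithLp.toLp 2 (coordY W x, coordZ W x)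
      map_add' := fun p q => by simp only [combine, WithLp.add_fst, WithLp.add_snd, map_add]; abel
      map_smul' := fun c p => by simp [combine]
      left_inv := fun p => by simp only [coordY_combine hW, coordZ_combine hW]; rfl
      right_inv := fun x => by simp [combine_coord hW] }
    (fun p => by
      have h := norm_sq_combine hW p.fst p.snd
      rw [← WithLp.prod_norm_sq_eq_of_L2] at h
      exact (sq_eq_sq₀ (norm_nonneg _) (norm_nonneg _)).1 h)

/-- The inclusion of the slice directions. -/
noncomputable def tailIsometry (hW : W ∈ Matrix.orthogonalGroup (Fin (n + l)) ℝ) :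
    𝔼 l →ₗᵢ[ℝ] 𝔼 (n + l) where
  toLinearMap := Matrix.toEuclideanLin (tailCols W)
  norm_map' z := by
    have h := norm_sq_combine hW 0 z
    simp only [combine, map_zero, zero_add, norm_zero, ne_eq, OfNat.ofNat_ne_zero,
      not_false_eq_true, zero_pow] at h
    exact (sq_eq_sq₀ (norm_nonneg _) (norm_nonneg _)).1 h

/-- Reconciles two parametrisations of a fibre: the Poincaré constant places the origin at x, while
`condZ` places it at z = 0. They differ by the shift `coordZ W x`. -/
lemma combine_coordY_add (hW : W ∈ Matrix.orthogonalGroup (Fin (n + l)) ℝ) (x : 𝔼 (n + l))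
    (z : 𝔼 l) : combine W (coordY W x) (coordZ W x + z) = x + tailIsometry hW z := by
  conv_rhs => rw [← combine_coord hW x]
  simp only [combine, map_add, tailIsometry]
  exact (add_assoc _ _ _).symm

lemma measurePreserving_combine (hW : W ∈ Matrix.orthogonalGroup (Fin (n + l)) ℝ) :
    MeasurePreserving (fun p : 𝔼 n × 𝔼 l => combine W p.1 p.2) (volume.prod volume) volume :=
  (combineIsometry hW).measurePreserving.comp (WithLp.volume_preserving_toLp (𝔼 n) (𝔼 l))

lemma measurable_coordY : Measurable (coordY W) :=
  (LinearMap.continuous_of_finiteDimensional _).measurable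

lemma measurable_coordZ : Measurable (coordZ W) :=
  (LinearMap.continuous_of_finiteDimensional _).measurable

lemma measurable_combine : Measurable (fun p : 𝔼 n × 𝔼 l => combine W p.1 p.2) := by
  have h1 : Measurable (Matrix.toEuclideanLin (headCols W)) :=
    (LinearMap.continuous_of_finiteDimensional _).measurable
  have h2 : Measurable (Matrix.toEuclideanLin (tailCols W)) :=
    (LinearMap.continuous_of_finiteDimensional _).measurable
  exact (h1.comp measurable_fst).add (h2.comp measurable_snd)

lemma measurable_combine_swap : Measurable (fun p : 𝔼 l × 𝔼 n => combine W p.2 p.1) := by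
  have h := (measurable_combine (W := W)).comp (measurable_swap (α := 𝔼 l) (β := 𝔼 n))
  exact h

lemma measurable_combine_left (y : 𝔼 n) : Measurable (fun z : 𝔼 l => combine W y z) := by
  have h2 : Measurable (Matrix.toEuclideanLin (tailCols W)) :=
    (LinearMap.continuous_of_finiteDimensional _).measurable
  exact measurable_const.add h2

lemma measurable_combine_right (z : 𝔼 l) : Measurable (fun y : 𝔼 n => combine W y z) := by
  have h1 : Measurable (Matrix.toEuclideanLin (headCols W)) :=
    (LinearMap.continuous_of_finiteDimensional _).measurable
  exact h1.add measurable_const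

end CoordinateGeometry

/-! ### Integration against normalized densities. -/

section NormalizedDensity

variable {k a b : ℕ}

lemma lintegral_normalizedDensity {g : 𝔼 k → ℝ} (hg : Measurable g) (h : 𝔼 k → ℝ≥0∞) :
    ∫⁻ z, h z ∂(normalizedDensity g) =
      (∫⁻ z, ENNReal.ofReal (g z))⁻¹ * ∫⁻ z, ENNReal.ofReal (g z) * h z := by
  rw [normalizedDensity, lintegral_smul_measure, smul_eq_mul,
    lintegral_withDensity_eq_lintegral_mul_non_measurable _ hg.ennreal_ofReal
      (Filter.Eventually.of_forall fun _ => ENNReal.ofReal_lt_top)]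
  rfl

/-- Zero mass is harmless: the density then vanishes almost everywhere and both sides are 0. Only
infinite mass must be excluded, so disintegration needs no positivity of marginals. -/
lemma mass_mul_lintegral_normalizedDensity {g : 𝔼 k → ℝ} (hg : Measurable g)
    (hfin : ∫⁻ z, ENNReal.ofReal (g z) ≠ ⊤) (h : 𝔼 k → ℝ≥0∞) :
    (∫⁻ z, ENNReal.ofReal (g z)) * ∫⁻ z, h z ∂(normalizedDensity g) =
      ∫⁻ z, ENNReal.ofReal (g z) * h z := by
  rw [lintegral_normalizedDensity hg, ← mul_assoc]
  by_cases h0 : ∫⁻ z, ENNReal.ofReal (g z) = 0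
  · have h1 : ∀ᵐ z, ENNReal.ofReal (g z) = 0 := (lintegral_eq_zero_iff hg.ennreal_ofReal).1 h0
    rw [h0, zero_mul, zero_mul, lintegral_congr_ae (g := fun _ => 0), lintegral_zero]
    filter_upwards [h1] with z hz
    rw [hz, zero_mul]
  · rw [ENNReal.mul_inv_cancel h0 hfin, one_mul]

lemma isProbabilityMeasure_normalizedDensity {g : 𝔼 k → ℝ}
    (h0 : ∫⁻ z, ENNReal.ofReal (g z) ≠ 0) (hfin : ∫⁻ z, ENNReal.ofReal (g z) ≠ ⊤) :
    IsProbabilityMeasure (normalizedDensity g) := by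
  constructor
  rw [normalizedDensity, Measure.smul_apply, withDensity_apply _ MeasurableSet.univ,
    Measure.restrict_univ, smul_eq_mul, ENNReal.inv_mul_cancel h0 hfin]

lemma normalizedDensity_map_add_left {g : 𝔼 k → ℝ} (hg : Measurable g) (c : 𝔼 k) :
    (normalizedDensity fun z => g (c + z)).map (fun z => c + z) = normalizedDensity g := by
  have hm : Measurable fun z : 𝔼 k => c + z := measurable_const_add c
  refine Measure.ext_of_lintegral _ fun h hh => ?_
  have hgc : Measurable fun z => g (c + z) := hg.comp hm
  rw [lintegral_map hh hm, lintegral_normalizedDensity hgc, lintegral_normalizedDensity hg,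
    lintegral_add_left_eq_self (fun z => ENNReal.ofReal (g z) * h z) c,
    lintegral_add_left_eq_self (fun z => ENNReal.ofReal (g z)) c]

lemma measurable_lintegral_normalizedDensity {q : 𝔼 a → 𝔼 b → ℝ}
    (hq : Measurable (Function.uncurry q)) {h : 𝔼 a → 𝔼 b → ℝ≥0∞}
    (hh : Measurable (Function.uncurry h)) :
    Measurable fun s => ∫⁻ t, h s t ∂(normalizedDensity (q s)) := by
  simp_rw [fun s => lintegral_normalizedDensity (g := q s) (hq.comp measurable_prodMk_left) (h s)]
  exact (Measurable.lintegral_prod_right hq.ennreal_ofReal).inv.mul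
    (Measurable.lintegral_prod_right (hq.ennreal_ofReal.mul hh))

/-- The integral unfolds to an inverse mass times a parameter integral against Lebesgue measure, and
each factor is measurable in the parameter. -/
lemma measurable_integral_normalizedDensity {q : 𝔼 a → 𝔼 b → ℝ}
    (hq : Measurable (Function.uncurry q)) {u : 𝔼 a → 𝔼 b → ℝ}
    (hu : Measurable (Function.uncurry u)) :
    Measurable fun s => ∫ t, u s t ∂(normalizedDensity (q s)) := by
  have h1 : ∀ s, ∫ t, u s t ∂(normalizedDensity (q s)) =
      ((∫⁻ z, ENNReal.ofReal (q s z))⁻¹).toReal *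
        ∫ t, (ENNReal.ofReal (q s t)).toReal * u s t := fun s => by
    have hqs : Measurable (q s) := hq.comp measurable_prodMk_left
    rw [normalizedDensity, integral_smul_measure,
      integral_withDensity_eq_integral_toReal_smul
        hqs.ennreal_ofReal (Filter.Eventually.of_forall fun _ => ENNReal.ofReal_lt_top)]
    rfl
  simp_rw [h1]
  refine (Measurable.lintegral_prod_right hq.ennreal_ofReal).inv.ennreal_toReal.mul ?_
  exact (StronglyMeasurable.integral_prod_right
    (hq.ennreal_ofReal.ennreal_toReal.mul hu).stronglyMeasurable).measurable

lemma lintegral_lintegral_mul_normalizedDensity {q : 𝔼 a → 𝔼 b → ℝ}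
    (hq : Measurable (Function.uncurry q))
    (hfin : ∫⁻ s, ∫⁻ t, ENNReal.ofReal (q s t) ≠ ⊤) (h : 𝔼 a → 𝔼 b → ℝ≥0∞) :
    ∫⁻ s, ∫⁻ t, ENNReal.ofReal (q s t) * ∫⁻ t', h s t' ∂(normalizedDensity (q s)) =
      ∫⁻ s, ∫⁻ t, ENNReal.ofReal (q s t) * h s t := by
  refine lintegral_congr_ae ?_
  filter_upwards [ae_lt_top (Measurable.lintegral_prod_right hq.ennreal_ofReal) hfin] with s hs
  have hqs : Measurable (q s) := hq.comp measurable_prodMk_left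
  rw [lintegral_mul_const _ hqs.ennreal_ofReal]
  exact mass_mul_lintegral_normalizedDensity hqs hs.ne (h s)

end NormalizedDensity

/-! ### Disintegration of the input measure along y and along z. -/

section Disintegration

variable {n l : ℕ} {W : Matrix (Fin (n + l)) (Fin (n + l)) ℝ} {ρ : 𝔼 (n + l) → ℝ}

lemma isProbabilityMeasure_inputMeasure (hρ1 : ∫⁻ x, ENNReal.ofReal (ρ x) = 1) :
    IsProbabilityMeasure (inputMeasure ρ) := by
  constructor
  rw [inputMeasure, withDensity_apply _ MeasurableSet.univ, Measure.restrict_univ, hρ1]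

lemma measurable_density_combine (hρ : Measurable ρ) :
    Measurable (Function.uncurry fun (y : 𝔼 n) (z : 𝔼 l) => ρ (combine W y z)) :=
  hρ.comp measurable_combine

lemma measurable_density_combine_swap (hρ : Measurable ρ) :
    Measurable (Function.uncurry fun (z : 𝔼 l) (y : 𝔼 n) => ρ (combine W y z)) :=
  hρ.comp (measurable_combine_swap (W := W))

lemma measurable_lintegral_condZ (hρ : Measurable ρ) {h : 𝔼 n → 𝔼 l → ℝ≥0∞}
    (hh : Measurable (Function.uncurry h)) :
    Measurable fun y => ∫⁻ z, h y z ∂(condZ ρ W y) :=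
  measurable_lintegral_normalizedDensity (measurable_density_combine hρ) hh

lemma measurable_lintegral_condY (hρ : Measurable ρ) {h : 𝔼 n → 𝔼 l → ℝ≥0∞}
    (hh : Measurable (Function.uncurry h)) :
    Measurable fun z => ∫⁻ y, h y z ∂(condY ρ W z) :=
  measurable_lintegral_normalizedDensity (h := fun z y => h y z)
    (measurable_density_combine_swap hρ) (hh.comp measurable_swap)

lemma measurable_integral_condZ (hρ : Measurable ρ) {f : 𝔼 (n + l) → ℝ} (hf : Measurable f) :
    Measurable fun y => ∫ z, f (combine W y z) ∂(condZ ρ W y) :=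
  measurable_integral_normalizedDensity (u := fun y z => f (combine W y z))
    (measurable_density_combine hρ) (measurable_density_combine hf)

lemma measurable_marginalY (hρ : Measurable ρ) : Measurable (marginalY ρ W) :=
  Measurable.lintegral_prod_right (measurable_density_combine hρ).ennreal_ofReal

lemma lintegral_inputMeasure (hW : W ∈ Matrix.orthogonalGroup (Fin (n + l)) ℝ)
    (hρ : Measurable ρ) {h : 𝔼 (n + l) → ℝ≥0∞} (hh : Measurable h) :
    ∫⁻ x, h x ∂(inputMeasure ρ) =
      ∫⁻ y : 𝔼 n, ∫⁻ z : 𝔼 l, ENNReal.ofReal (ρ (combine W y z)) * h (combine W y z) := by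
  have hm : Measurable ((fun x => ENNReal.ofReal (ρ x)) * h) := hρ.ennreal_ofReal.mul hh
  have hc : Measurable fun p : 𝔼 n × 𝔼 l =>
      ((fun x => ENNReal.ofReal (ρ x)) * h) (combine W p.1 p.2) := hm.comp measurable_combine
  rw [inputMeasure, lintegral_withDensity_eq_lintegral_mul _ hρ.ennreal_ofReal hh,
    ← (measurePreserving_combine hW).lintegral_comp hm, lintegral_prod _ hc.aemeasurable]
  rfl

lemma lintegral_lintegral_density (hW : W ∈ Matrix.orthogonalGroup (Fin (n + l)) ℝ)
    (hρ : Measurable ρ) (hρ1 : ∫⁻ x, ENNReal.ofReal (ρ x) = 1) :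
    ∫⁻ y : 𝔼 n, ∫⁻ z : 𝔼 l, ENNReal.ofReal (ρ (combine W y z)) = 1 := by
  have := isProbabilityMeasure_inputMeasure hρ1
  have h := lintegral_inputMeasure hW hρ (h := fun _ => 1) measurable_const
  simpa using h.symm

/-- The tower property: resampling z from its conditional law given y leaves the joint law
unchanged. -/
lemma lintegral_lintegral_condZ (hW : W ∈ Matrix.orthogonalGroup (Fin (n + l)) ℝ)
    (hρ : Measurable ρ) (hρ1 : ∫⁻ x, ENNReal.ofReal (ρ x) = 1) {h : 𝔼 n → 𝔼 l → ℝ≥0∞}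
    (hh : Measurable (Function.uncurry h)) :
    ∫⁻ x, ∫⁻ z, h (coordY W x) z ∂(condZ ρ W (coordY W x)) ∂(inputMeasure ρ) =
      ∫⁻ x, h (coordY W x) (coordZ W x) ∂(inputMeasure ρ) := by
  have h1 : Measurable fun x => ∫⁻ z, h (coordY W x) z ∂(condZ ρ W (coordY W x)) :=
    (measurable_lintegral_condZ hρ hh).comp measurable_coordY
  have h2 : Measurable fun x => h (coordY W x) (coordZ W x) :=
    hh.comp (measurable_coordY.prodMk measurable_coordZ)
  rw [lintegral_inputMeasure hW hρ h1, lintegral_inputMeasure hW hρ h2]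
  simp only [coordY_combine hW, coordZ_combine hW]
  exact lintegral_lintegral_mul_normalizedDensity (measurable_density_combine hρ)
    (by rw [lintegral_lintegral_density hW hρ hρ1]; exact ENNReal.one_ne_top) h

/-- The tower property with the roles of y and z exchanged, obtained by Tonelli. It is the form in
which the response-surface assumption is stated. -/
lemma lintegral_lintegral_condY (hW : W ∈ Matrix.orthogonalGroup (Fin (n + l)) ℝ)
    (hρ : Measurable ρ) (hρ1 : ∫⁻ x, ENNReal.ofReal (ρ x) = 1) {h : 𝔼 n → 𝔼 l → ℝ≥0∞}
    (hh : Measurable (Function.uncurry h)) :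
    ∫⁻ z, ∫⁻ y, h y z ∂(condY ρ W z) ∂((inputMeasure ρ).map (coordZ W)) =
      ∫⁻ x, h (coordY W x) (coordZ W x) ∂(inputMeasure ρ) := by
  have hm := measurable_lintegral_condY (W := W) hρ hh
  have h1 : Measurable fun x => ∫⁻ y, h y (coordZ W x) ∂(condY ρ W (coordZ W x)) :=
    hm.comp measurable_coordZ
  have h2 : Measurable fun x => h (coordY W x) (coordZ W x) :=
    hh.comp (measurable_coordY.prodMk measurable_coordZ)
  have hq : Measurable (Function.uncurry fun (y : 𝔼 n) (z : 𝔼 l) =>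
      ENNReal.ofReal (ρ (combine W y z))) := (measurable_density_combine hρ).ennreal_ofReal
  have h3 : Measurable (Function.uncurry fun (y : 𝔼 n) (z : 𝔼 l) =>
      ENNReal.ofReal (ρ (combine W y z)) * ∫⁻ y', h y' z ∂(condY ρ W z)) :=
    hq.mul (hm.comp measurable_snd)
  have h4 : Measurable (Function.uncurry fun (y : 𝔼 n) (z : 𝔼 l) =>
      ENNReal.ofReal (ρ (combine W y z)) * h y z) := hq.mul hh
  rw [lintegral_map hm measurable_coordZ, lintegral_inputMeasure hW hρ h1,
    lintegral_inputMeasure hW hρ h2]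
  simp only [coordY_combine hW, coordZ_combine hW]
  rw [lintegral_lintegral_swap h3.aemeasurable, lintegral_lintegral_swap h4.aemeasurable]
  refine lintegral_lintegral_mul_normalizedDensity (q := fun z y => ρ (combine W y z))
    (measurable_density_combine_swap hρ) ?_ fun z y => h y z
  rw [← lintegral_lintegral_swap hq.aemeasurable, lintegral_lintegral_density hW hρ hρ1]
  exact ENNReal.one_ne_top

/-- Infinite marginals occur only on a Lebesgue-null set because the total mass is 1; fibres with
zero marginal carry no input mass. -/
lemma ae_marginalY (hW : W ∈ Matrix.orthogonalGroup (Fin (n + l)) ℝ)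
    (hρ : Measurable ρ) (hρ1 : ∫⁻ x, ENNReal.ofReal (ρ x) = 1) :
    ∀ᵐ x ∂(inputMeasure ρ), marginalY ρ W (coordY W x) ≠ 0 ∧ marginalY ρ W (coordY W x) ≠ ⊤ := by
  let S : Set (𝔼 n) := {y | ¬ (marginalY ρ W y ≠ 0 ∧ marginalY ρ W y ≠ ⊤)}
  have hM := measurable_marginalY (W := W) hρ
  have hS : MeasurableSet S := by
    have h1 : MeasurableSet {y | marginalY ρ W y ≠ 0} :=
      (hM (measurableSet_singleton 0)).compl
    have h2 : MeasurableSet {y | marginalY ρ W y ≠ ⊤} :=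
      (hM (measurableSet_singleton ⊤)).compl
    exact (h1.inter h2).compl
  have hSx := measurable_coordY (W := W) hS
  have h : inputMeasure ρ (coordY W ⁻¹' S) = 0 := by
    rw [← lintegral_indicator_one hSx,
      lintegral_inputMeasure hW hρ (measurable_one.indicator hSx)]
    have hfin : ∀ᵐ y : 𝔼 n, marginalY ρ W y < ⊤ := ae_lt_top hM (by
      have := lintegral_lintegral_density hW hρ hρ1
      unfold marginalY
      rw [this]
      exact ENNReal.one_ne_top)
    rw [lintegral_congr_ae (g := fun _ => 0), lintegral_zero]
    filter_upwards [hfin] with y hy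
    have hq : Measurable fun z : 𝔼 l => ENNReal.ofReal (ρ (combine W y z)) :=
      (hρ.comp (measurable_combine_left y)).ennreal_ofReal
    have h1 : ∀ z : 𝔼 l, (coordY W ⁻¹' S).indicator (1 : 𝔼 (n + l) → ℝ≥0∞) (combine W y z) =
        S.indicator 1 y := fun z => by
      simp only [Set.indicator, Set.mem_preimage, coordY_combine hW, Pi.one_apply]
    simp_rw [h1]
    rw [lintegral_mul_const _ hq]
    by_cases hyS : y ∈ S
    · have : marginalY ρ W y = 0 := by
        by_contra h0
        exact hyS ⟨h0, hy.ne⟩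
      unfold marginalY at this
      rw [this, zero_mul]
    · rw [Set.indicator_of_notMem hyS, mul_zero]
  exact h

lemma ae_isProbabilityMeasure_condZ (hW : W ∈ Matrix.orthogonalGroup (Fin (n + l)) ℝ)
    (hρ : Measurable ρ) (hρ1 : ∫⁻ x, ENNReal.ofReal (ρ x) = 1) :
    ∀ᵐ x ∂(inputMeasure ρ), IsProbabilityMeasure (condZ ρ W (coordY W x)) := by
  filter_upwards [ae_marginalY hW hρ hρ1] with x hx
  exact isProbabilityMeasure_normalizedDensity hx.1 hx.2

/-- An exceptional set need not be measurable. The indicator of a measurable null superset lets the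
tower property, which needs a measurable integrand, act on almost-everywhere statements. -/
lemma exists_measurable_majorant_of_ae {α : Type*} [MeasurableSpace α] {μ : Measure α}
    {p : α → Prop} (hp : ∀ᵐ x ∂μ, p x) :
    ∃ g : α → ℝ≥0∞, Measurable g ∧ ∫⁻ x, g x ∂μ = 0 ∧ ∀ x, g x = 0 → p x := by
  obtain ⟨S, hS, hSm, hS0⟩ := exists_measurable_superset_of_null (ae_iff.1 hp)
  refine ⟨S.indicator 1, measurable_one.indicator hSm, ?_, fun x hx => ?_⟩
  · rw [lintegral_indicator_one hSm, hS0]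
  · by_contra hc
    rw [Set.indicator_of_mem (hS hc)] at hx
    exact one_ne_zero hx

/-- By the tower property the indicator of the exceptional set has iterated integral zero, hence
zero integral on almost every fibre. -/
lemma ae_condZ_of_ae (hW : W ∈ Matrix.orthogonalGroup (Fin (n + l)) ℝ)
    (hρ : Measurable ρ) (hρ1 : ∫⁻ x, ENNReal.ofReal (ρ x) = 1) {p : 𝔼 (n + l) → Prop}
    (hp : ∀ᵐ x ∂(inputMeasure ρ), p x) :
    ∀ᵐ x ∂(inputMeasure ρ), ∀ᵐ z ∂(condZ ρ W (coordY W x)), p (combine W (coordY W x) z) := by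
  obtain ⟨g, hg, hg0, hgp⟩ := exists_measurable_majorant_of_ae hp
  have hh : Measurable (Function.uncurry fun (y : 𝔼 n) (z : 𝔼 l) => g (combine W y z)) :=
    hg.comp measurable_combine
  have h0 := lintegral_lintegral_condZ hW hρ hρ1 hh
  simp_rw [combine_coord hW] at h0
  have h1 : Measurable fun x => ∫⁻ z, g (combine W (coordY W x) z) ∂(condZ ρ W (coordY W x)) :=
    (measurable_lintegral_condZ hρ hh).comp measurable_coordY
  filter_upwards [(lintegral_eq_zero_iff h1).1 (h0.trans hg0)] with x hx
  have h2 : Measurable fun z => g (combine W (coordY W x) z) :=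
    hg.comp (measurable_combine_left _)
  filter_upwards [(lintegral_eq_zero_iff h2).1 hx] with z hz
  exact hgp _ hz

lemma ae_condY_of_ae (hW : W ∈ Matrix.orthogonalGroup (Fin (n + l)) ℝ)
    (hρ : Measurable ρ) (hρ1 : ∫⁻ x, ENNReal.ofReal (ρ x) = 1) {p : 𝔼 (n + l) → Prop}
    (hp : ∀ᵐ x ∂(inputMeasure ρ), p x) :
    ∀ᵐ z ∂((inputMeasure ρ).map (coordZ W)), ∀ᵐ y ∂(condY ρ W z), p (combine W y z) := by
  obtain ⟨g, hg, hg0, hgp⟩ := exists_measurable_majorant_of_ae hp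
  have hh : Measurable (Function.uncurry fun (y : 𝔼 n) (z : 𝔼 l) => g (combine W y z)) :=
    hg.comp measurable_combine
  have h0 := lintegral_lintegral_condY hW hρ hρ1 hh
  simp_rw [combine_coord hW] at h0
  filter_upwards [(lintegral_eq_zero_iff (measurable_lintegral_condY hρ hh)).1 (h0.trans hg0)]
    with z hz
  have h2 : Measurable fun y => g (combine W y z) :=
    hg.comp (measurable_combine_right z)
  filter_upwards [(lintegral_eq_zero_iff h2).1 hz] with y hy
  exact hgp _ hy

end Disintegration

/-! ### The Poincaré inequality on slices and its average. -/

section Poincare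

variable {n l : ℕ} {W : Matrix (Fin (n + l)) (Fin (n + l)) ℝ} {ρ : 𝔼 (n + l) → ℝ}

lemma inner_coordZ (v : 𝔼 (n + l)) (w : 𝔼 l) :
    inner ℝ (coordZ W v) w = inner ℝ v (Matrix.toEuclideanLin (tailCols W) w) := by
  simp only [coordZ, Matrix.toLpLin_apply, EuclideanSpace.inner_eq_star_dotProduct, star_trivial]
  rw [Matrix.mulVec_transpose, dotProduct_comm, ← Matrix.dotProduct_mulVec, dotProduct_comm]

/-- Chain rule: the gradient is pulled back by the adjoint of the slice inclusion, and that adjoint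
is `coordZ W`. -/
lemma gradient_slice (hW : W ∈ Matrix.orthogonalGroup (Fin (n + l)) ℝ) {f : 𝔼 (n + l) → ℝ}
    {x : 𝔼 (n + l)} {z : 𝔼 l} (hf : DifferentiableAt ℝ f (x + tailIsometry hW z)) :
    HasGradientAt (fun z => f (x + tailIsometry hW z))
      (coordZ W (gradient f (x + tailIsometry hW z))) z := by
  rw [hasGradientAt_iff_hasFDerivAt]
  have h1 := (hasGradientAt_iff_hasFDerivAt.1 hf.hasGradientAt).comp z
    (((tailIsometry hW).toContinuousLinearMap.hasFDerivAt (x := z)).const_add x)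
  refine h1.congr_fderiv ?_
  ext w
  simp only [ContinuousLinearMap.comp_apply, InnerProductSpace.toDual_apply_apply, inner_coordZ]
  rfl

lemma measurable_gradient {k : ℕ} (f : 𝔼 k → ℝ) : Measurable (gradient f) :=
  (InnerProductSpace.toDual ℝ (𝔼 k)).symm.continuous.measurable.comp (measurable_fderiv ℝ f)

lemma evariance_map {α β : Type*} [MeasurableSpace α] [MeasurableSpace β] {μ : Measure α}
    {φ : α → β} (hφ : Measurable φ) {u : β → ℝ} (hu : Measurable u) :
    ProbabilityTheory.evariance u (μ.map φ) = ProbabilityTheory.evariance (fun a => u (φ a)) μ := by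
  unfold ProbabilityTheory.evariance
  rw [integral_map hφ.aemeasurable hu.aestronglyMeasurable,
    lintegral_map ((hu.sub_const _).enorm.pow_const 2) hφ]

lemma norm_coordZ_le (hW : W ∈ Matrix.orthogonalGroup (Fin (n + l)) ℝ) (x : 𝔼 (n + l)) :
    ‖coordZ W x‖ ≤ ‖x‖ := by
  have h := norm_sq_combine hW (coordY W x) (coordZ W x)
  rw [combine_coord hW] at h
  refine (sq_le_sq₀ (norm_nonneg _) (norm_nonneg _)).1 ?_
  rw [h]
  exact le_add_of_nonneg_left (sq_nonneg _)

/-- The conditional second moments average to the finite total second moment, so almost all of them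
are finite. -/
lemma ae_memLp_condZ {E : Type*} [NormedAddCommGroup E] [MeasurableSpace E] [BorelSpace E]
    [SecondCountableTopology E] (hW : W ∈ Matrix.orthogonalGroup (Fin (n + l)) ℝ)
    (hρ : Measurable ρ) (hρ1 : ∫⁻ x, ENNReal.ofReal (ρ x) = 1) {g : 𝔼 (n + l) → E}
    (hgm : Measurable g) (hg : MemLp g 2 (inputMeasure ρ)) :
    ∀ᵐ x ∂(inputMeasure ρ),
      MemLp (fun z => g (combine W (coordY W x) z)) 2 (condZ ρ W (coordY W x)) := by
  have hsq : Measurable fun x => ‖g x‖ₑ ^ 2 := hgm.enorm.pow_const 2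
  have hh : Measurable (Function.uncurry fun (y : 𝔼 n) (z : 𝔼 l) => ‖g (combine W y z)‖ₑ ^ 2) :=
    hsq.comp measurable_combine
  have h0 := lintegral_lintegral_condZ hW hρ hρ1 hh
  simp_rw [combine_coord hW] at h0
  have hfin : ∫⁻ x, ‖g x‖ₑ ^ 2 ∂(inputMeasure ρ) ≠ ⊤ := by
    have h := (eLpNorm_lt_top_iff_lintegral_rpow_enorm_lt_top two_ne_zero
      ENNReal.ofNat_ne_top).1 hg.2
    simpa using h.ne
  rw [← h0] at hfin
  have h1 : Measurable fun x =>
      ∫⁻ z, ‖g (combine W (coordY W x) z)‖ₑ ^ 2 ∂(condZ ρ W (coordY W x)) :=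
    (measurable_lintegral_condZ hρ hh).comp measurable_coordY
  refine (ae_lt_top h1 hfin).mono fun x hx => ?_
  have h2 : Measurable fun z => g (combine W (coordY W x) z) :=
    hgm.comp (measurable_combine_left _)
  refine ⟨h2.aestronglyMeasurable, ?_⟩
  rw [eLpNorm_lt_top_iff_lintegral_rpow_enorm_lt_top two_ne_zero ENNReal.ofNat_ne_top]
  simpa using hx

lemma slice_map (hW : W ∈ Matrix.orthogonalGroup (Fin (n + l)) ℝ) (hρ : Measurable ρ)
    (x : 𝔼 (n + l)) :
    (normalizedDensity fun z => ρ (x + tailIsometry hW z)).map (fun z => coordZ W x + z) =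
      condZ ρ W (coordY W x) := by
  have hg : Measurable fun z : 𝔼 l => ρ (combine W (coordY W x) z) :=
    hρ.comp (measurable_combine_left _)
  have h := normalizedDensity_map_add_left hg (coordZ W x)
  simp only [combine_coordY_add hW] at h
  exact h

lemma segment_image_isometry {k m : ℕ} (V : 𝔼 k →ₗᵢ[ℝ] 𝔼 m) (x : 𝔼 m) (a b : 𝔼 k) (t : ℝ) :
    x + V (AffineMap.lineMap a b t) = AffineMap.lineMap (x + V a) (x + V b) t := by
  simp only [AffineMap.lineMap_apply, vsub_eq_sub, vadd_eq_add, map_add, map_smul, map_sub,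
    add_sub_add_left_eq_sub]
  abel

/-- Segments of the slice map affinely to segments in X, and the remaining conditions pass to almost
every fibre by disintegration. The slice gradient is a projection of the full one, hence no larger.
-/
lemma ae_isAdmissible_slice (hW : W ∈ Matrix.orthogonalGroup (Fin (n + l)) ℝ)
    (hρ : Measurable ρ) (hρ1 : ∫⁻ x, ENNReal.ofReal (ρ x) = 1) {X : Set (𝔼 (n + l))}
    {f : 𝔼 (n + l) → ℝ} (hf : IsAdmissible X (inputMeasure ρ) f) :
    ∀ᵐ x ∂(inputMeasure ρ), IsAdmissible {z | x + tailIsometry hW z ∈ X}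
      (normalizedDensity fun z => ρ (x + tailIsometry hW z))
      (fun z => f (x + tailIsometry hW z)) := by
  filter_upwards [ae_condZ_of_ae hW hρ hρ1 hf.differentiable,
    ae_memLp_condZ hW hρ hρ1 hf.measurable hf.sq_integrable,
    ae_memLp_condZ hW hρ hρ1 (measurable_gradient f) hf.grad_sq_integrable] with x hd h2 hg
  have hshift : MeasurePreserving (fun z : 𝔼 l => coordZ W x + z)
      (normalizedDensity fun z => ρ (x + tailIsometry hW z)) (condZ ρ W (coordY W x)) :=
    ⟨measurable_const_add _, slice_map hW hρ x⟩
  have hd' := hshift.quasiMeasurePreserving.ae hd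
  have h2' := h2.comp_measurePreserving hshift
  have hg' := hg.comp_measurePreserving hshift
  simp only [Function.comp_def, combine_coordY_add hW] at hd' h2' hg'
  refine ⟨?_, fun a b hab => ?_, ?_, h2', ?_⟩
  · exact hf.measurable.comp
      (measurable_const.add (tailIsometry hW).continuous.measurable)
  · simp_rw [segment_image_isometry]
    refine hf.absCont _ _ ?_
    rw [segment_eq_image_lineMap] at hab ⊢
    rintro _ ⟨t, ht, rfl⟩
    rw [← segment_image_isometry]
    exact hab ⟨t, ht, rfl⟩
  · filter_upwards [hd'] with z hz using (gradient_slice hW hz).differentiableAt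
  · refine hg'.mono (measurable_gradient _).aestronglyMeasurable ?_
    filter_upwards [hd'] with z hz
    rw [(gradient_slice hW hz).gradient]
    exact norm_coordZ_le hW _

lemma ae_evariance_condZ_le (hW : W ∈ Matrix.orthogonalGroup (Fin (n + l)) ℝ)
    (hρ : Measurable ρ) (hρ1 : ∫⁻ x, ENNReal.ofReal (ρ x) = 1) {X : Set (𝔼 (n + l))}
    {f : 𝔼 (n + l) → ℝ} (hf : IsAdmissible X (inputMeasure ρ) f) {C : ℝ≥0∞}
    (hC : ∀ᵐ x ∂(inputMeasure ρ), ∀ u : 𝔼 l → ℝ,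
      IsAdmissible {z | x + tailIsometry hW z ∈ X}
        (normalizedDensity fun z => ρ (x + tailIsometry hW z)) u →
      ProbabilityTheory.evariance u (normalizedDensity fun z => ρ (x + tailIsometry hW z)) ≤
        C * ∫⁻ z, ‖gradient u z‖ₑ ^ 2
          ∂(normalizedDensity fun z => ρ (x + tailIsometry hW z))) :
    ∀ᵐ x ∂(inputMeasure ρ),
      ProbabilityTheory.evariance (fun z => f (combine W (coordY W x) z))
          (condZ ρ W (coordY W x)) ≤
        C * ∫⁻ z, ‖coordZ W (gradient f (combine W (coordY W x) z))‖ₑ ^ 2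
          ∂(condZ ρ W (coordY W x)) := by
  filter_upwards [hC, ae_isAdmissible_slice hW hρ hρ1 hf,
    ae_condZ_of_ae hW hρ hρ1 hf.differentiable] with x hx hadm hd
  have hshift : Measurable (fun z : 𝔼 l => coordZ W x + z) := measurable_const_add _
  have hd' := (MeasurePreserving.mk hshift (slice_map hW hρ x)).quasiMeasurePreserving.ae hd
  have hfm : Measurable fun z => f (combine W (coordY W x) z) :=
    hf.measurable.comp (measurable_combine_left _)
  have hgm : Measurable fun z => ‖coordZ W (gradient f (combine W (coordY W x) z))‖ₑ ^ 2 :=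
    ((measurable_coordZ.comp ((measurable_gradient f).comp
      (measurable_combine_left _))).enorm.pow_const 2)
  rw [← slice_map hW hρ x, evariance_map hshift hfm, lintegral_map hgm hshift]
  simp only [combine_coordY_add hW] at hd' ⊢
  refine (hx _ hadm).trans_eq ?_
  congr 1
  refine lintegral_congr_ae ?_
  filter_upwards [hd'] with z hz
  rw [(gradient_slice hW hz).gradient]

/-- Each admissible constant C gives a pointwise bound whose average is C times the projected
gradient energy `K`. The infimum is taken after averaging, so it need not itself be shown to be
admissible. -/
lemma lintegral_evariance_condZ_le (hW : W ∈ Matrix.orthogonalGroup (Fin (n + l)) ℝ)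
    (hρ : Measurable ρ) (hρ1 : ∫⁻ x, ENNReal.ofReal (ρ x) = 1) {X : Set (𝔼 (n + l))}
    (hC : poincareConst X ρ ≠ ⊤) {f : 𝔼 (n + l) → ℝ} (hf : IsAdmissible X (inputMeasure ρ) f) :
    ∫⁻ x, ProbabilityTheory.evariance (fun z => f (combine W (coordY W x) z))
        (condZ ρ W (coordY W x)) ∂(inputMeasure ρ) ≤
      poincareConst X ρ * ∫⁻ x, ‖coordZ W (gradient f x)‖ₑ ^ 2 ∂(inputMeasure ρ) := by
  have hsq : Measurable fun x => ‖coordZ W (gradient f x)‖ₑ ^ 2 :=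
    (measurable_coordZ.comp (measurable_gradient f)).enorm.pow_const 2
  have hh : Measurable (Function.uncurry fun (y : 𝔼 n) (z : 𝔼 l) =>
      ‖coordZ W (gradient f (combine W y z))‖ₑ ^ 2) := hsq.comp measurable_combine
  have h0 := lintegral_lintegral_condZ hW hρ hρ1 hh
  simp_rw [combine_coord hW] at h0
  have h1 : Measurable fun x => ∫⁻ z, ‖coordZ W (gradient f (combine W (coordY W x) z))‖ₑ ^ 2
      ∂(condZ ρ W (coordY W x)) := (measurable_lintegral_condZ hρ hh).comp measurable_coordY
  set K := ∫⁻ x, ‖coordZ W (gradient f x)‖ₑ ^ 2 ∂(inputMeasure ρ) with hK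
  have hKfin : K ≠ ⊤ := by
    have h := (eLpNorm_lt_top_iff_lintegral_rpow_enorm_lt_top two_ne_zero
      ENNReal.ofNat_ne_top).1 hf.grad_sq_integrable.2
    refine ne_top_of_le_ne_top h.ne (lintegral_mono fun x => ?_)
    simp only [ENNReal.toReal_ofNat, ENNReal.rpow_ofNat]
    gcongr
    exact enorm_le_iff_norm_le.2 (norm_coordZ_le hW _)
  have key : ∀ C : ℝ≥0∞, C ∈ {C : ℝ≥0∞ | ∀ (k : ℕ) (V : 𝔼 k →ₗᵢ[ℝ] 𝔼 (n + l)),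
      ∀ᵐ x ∂(inputMeasure ρ), ∀ u : 𝔼 k → ℝ,
      IsAdmissible {z | x + V z ∈ X} (normalizedDensity fun z => ρ (x + V z)) u →
      ProbabilityTheory.evariance u (normalizedDensity fun z => ρ (x + V z)) ≤
        C * ∫⁻ z, ‖gradient u z‖ₑ ^ 2 ∂(normalizedDensity fun z => ρ (x + V z))} →
      ∫⁻ x, ProbabilityTheory.evariance (fun z => f (combine W (coordY W x) z))
        (condZ ρ W (coordY W x)) ∂(inputMeasure ρ) ≤ C * K := fun C hCmem => by
    refine (lintegral_mono_ae
      (ae_evariance_condZ_le hW hρ hρ1 hf (hCmem l (tailIsometry hW)))).trans_eq ?_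
    rw [lintegral_const_mul _ h1, h0]
  have hne := mt sInf_eq_top.2 hC
  push Not at hne
  -- Division by `K` is unavailable when it is zero; then any one admissible constant, which exists
  -- because the infimum is finite, gives the bound 0.
  by_cases hK0 : K = 0
  · obtain ⟨C, hCmem, -⟩ := hne
    have := key C hCmem
    rw [hK0, mul_zero] at this
    exact this.trans zero_le
  · rw [← ENNReal.div_le_iff hK0 hKfin]
    refine le_sInf fun C hCmem => ?_
    rw [ENNReal.div_le_iff hK0 hKfin]
    exact key C hCmem

end Poincare

/-! ### Spectral form of the gradient energy. -/

section GradientBound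

open Matrix

variable {m : ℕ} {ρ f : 𝔼 m → ℝ} {W : Matrix (Fin m) (Fin m) ℝ} {lam : Fin m → ℝ}

lemma memLp_coordinate {α : Type*} [MeasurableSpace α] {μ : Measure α} {g : α → 𝔼 m}
    (hg : MemLp g 2 μ) (i : Fin m) : MemLp (fun x => g x i) 2 μ :=
  hg.continuousLinearMap_comp (EuclideanSpace.proj i : 𝔼 m →L[ℝ] ℝ)

lemma integral_sq_dotProduct_gradient (hg : MemLp (fun x => gradient f x) 2 (inputMeasure ρ))
    (a : Fin m → ℝ) :
    ∫ x, (a ⬝ᵥ (gradient f x).ofLp) ^ 2 ∂(inputMeasure ρ) = a ⬝ᵥ gradMatrix ρ f *ᵥ a := by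
  have hint : ∀ i j, Integrable (fun x => (gradient f x) i * (gradient f x) j) (inputMeasure ρ) :=
    fun i j => (memLp_coordinate hg i).integrable_mul (memLp_coordinate hg j)
  have hexp : ∀ x, (a ⬝ᵥ (gradient f x).ofLp) ^ 2 =
      ∑ i, ∑ j, a i * a j * ((gradient f x) i * (gradient f x) j) := fun x => by
    rw [sq, dotProduct, Finset.sum_mul_sum]
    exact Finset.sum_congr rfl fun i _ => Finset.sum_congr rfl fun j _ => by ring
  simp_rw [hexp]
  rw [integral_finsetSum _ fun i _ => integrable_finsetSum _ fun j _ => (hint i j).const_mul _]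
  simp only [dotProduct, mulVec, gradMatrix, Matrix.of_apply]
  refine Finset.sum_congr rfl fun i _ => ?_
  rw [integral_finsetSum _ fun j _ => (hint i j).const_mul _, Finset.mul_sum]
  refine Finset.sum_congr rfl fun j _ => ?_
  rw [integral_const_mul]
  ring

lemma integral_sq_dotProduct_gradient_eq_sum
    (hg : MemLp (fun x => gradient f x) 2 (inputMeasure ρ))
    (hW : IsEigendecomposition (gradMatrix ρ f) W lam) (a : Fin m → ℝ) :
    ∫ x, (a ⬝ᵥ (gradient f x).ofLp) ^ 2 ∂(inputMeasure ρ) =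
      ∑ i, lam i * (W.col i ⬝ᵥ a) ^ 2 := by
  rw [integral_sq_dotProduct_gradient hg, hW.eq, ← Matrix.mulVec_mulVec, ← Matrix.mulVec_mulVec,
    Matrix.dotProduct_mulVec, ← Matrix.mulVec_transpose, dotProduct]
  refine Finset.sum_congr rfl fun i _ => ?_
  rw [Matrix.mulVec_diagonal]
  have : (Wᵀ *ᵥ a) i = W.col i ⬝ᵥ a := rfl
  rw [this]
  ring

lemma col_dotProduct_col (hW : W ∈ Matrix.orthogonalGroup (Fin m) ℝ) (i j : Fin m) :
    W.col i ⬝ᵥ W.col j = if i = j then 1 else 0 := by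
  have h := congrFun (congrFun ((Matrix.mem_orthogonalGroup_iff' (Fin m) ℝ).1 hW) i) j
  simpa [Matrix.mul_apply, Matrix.one_apply, star_eq_conjTranspose, dotProduct] using h

/-- Taking the direction a = wᵢ gives λᵢ = E[(wᵢ · ∇f)²]. -/
lemma eigenvalue_nonneg (hg : MemLp (fun x => gradient f x) 2 (inputMeasure ρ))
    (hW : IsEigendecomposition (gradMatrix ρ f) W lam) (i : Fin m) : 0 ≤ lam i := by
  have h := integral_sq_dotProduct_gradient_eq_sum hg hW (W.col i)
  simp only [col_dotProduct_col hW.orthogonal, ite_pow, one_pow, ne_eq, OfNat.ofNat_ne_zero,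
    not_false_eq_true, zero_pow, mul_ite, mul_one, mul_zero, Finset.sum_ite_eq',
    Finset.mem_univ, if_true] at h
  rw [← h]
  exact integral_nonneg fun x => sq_nonneg _

lemma norm_toLp_col (hW : W ∈ Matrix.orthogonalGroup (Fin m) ℝ) (i : Fin m) :
    ‖(WithLp.toLp 2 (W.col i) : 𝔼 m)‖ = 1 := by
  have h := col_dotProduct_col hW i i
  rw [if_pos rfl] at h
  refine (sq_eq_sq₀ (norm_nonneg _) zero_le_one).1 ?_
  rw [EuclideanSpace.real_norm_sq_eq, one_pow, ← h]
  simp [dotProduct, sq]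

/-- A column is the image of a unit basis vector, so the operator norm bounds it. -/
lemma IsPerturbation.norm_col_sub_le {W' : Matrix (Fin m) (Fin m) ℝ} {ε : ℝ}
    (h : IsPerturbation W W' ε) (i : Fin m) :
    ‖(WithLp.toLp 2 (W.col i - W'.col i) : 𝔼 m)‖ ≤ ε := by
  have h1 : (WithLp.toLp 2 (W.col i - W'.col i) : 𝔼 m) =
      Matrix.toEuclideanCLM (n := Fin m) (𝕜 := ℝ) (W - W') (EuclideanSpace.single i 1) := by
    ext j
    simp [Matrix.ofLp_toEuclideanCLM]
  rw [h1]
  refine (ContinuousLinearMap.le_opNorm _ _).trans ?_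
  simpa using h.dist_le

end GradientBound

/-! ### Gradient energy in the perturbed inactive directions. -/

section TailBound

open Matrix

variable {n l : ℕ} {ρ f : 𝔼 (n + l) → ℝ} {W W' : Matrix (Fin (n + l)) (Fin (n + l)) ℝ}
  {lam : Fin (n + l) → ℝ} {ε : ℝ}

lemma norm_sq_coordZ (v : 𝔼 (n + l)) :
    ‖coordZ W v‖ ^ 2 = ∑ j, (W.col (Fin.natAdd n j) ⬝ᵥ v.ofLp) ^ 2 := by
  rw [EuclideanSpace.real_norm_sq_eq]
  rfl

lemma coordZ_col_castAdd (hW : W ∈ Matrix.orthogonalGroup (Fin (n + l)) ℝ) (i : Fin n) :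
    coordZ W (WithLp.toLp 2 (W.col (Fin.castAdd l i))) = 0 := by
  have h : ‖coordZ W (WithLp.toLp 2 (W.col (Fin.castAdd l i)))‖ ^ 2 = 0 := by
    rw [norm_sq_coordZ]
    refine Finset.sum_eq_zero fun j _ => ?_
    have hne : Fin.natAdd n j ≠ Fin.castAdd l i := by
      intro h
      have h2 := congrArg Fin.val h
      simp at h2
      omega
    rw [col_dotProduct_col hW, if_neg hne]
    simp
  simpa using h

/-- The squared norm is a sum over the tail columns of `W'`. Each term is a quadratic form in C,
diagonal in the columns of `W`; exchanging the sums regroups by eigenvalue. -/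
lemma integral_norm_sq_coordZ_gradient
    (hg : MemLp (fun x => gradient f x) 2 (inputMeasure ρ))
    (hW : IsEigendecomposition (gradMatrix ρ f) W lam) :
    ∫ x, ‖coordZ W' (gradient f x)‖ ^ 2 ∂(inputMeasure ρ) =
      ∑ i, lam i * ‖coordZ W' (WithLp.toLp 2 (W.col i))‖ ^ 2 := by
  have hint : ∀ a : Fin (n + l) → ℝ,
      Integrable (fun x => (a ⬝ᵥ (gradient f x).ofLp) ^ 2) (inputMeasure ρ) := fun a => by
    have h : MemLp (fun x => a ⬝ᵥ (gradient f x).ofLp) 2 (inputMeasure ρ) :=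
      memLp_finsetSum _ fun i _ => (memLp_coordinate hg i).const_mul (a i)
    exact h.integrable_sq
  simp_rw [norm_sq_coordZ]
  rw [integral_finsetSum _ fun j _ => hint _]
  simp_rw [integral_sq_dotProduct_gradient_eq_sum hg hW, Finset.mul_sum]
  rw [Finset.sum_comm]
  exact Finset.sum_congr rfl fun i _ => Finset.sum_congr rfl fun j _ => by rw [dotProduct_comm]

lemma integral_norm_sq_coordZ_gradient_le
    (hg : MemLp (fun x => gradient f x) 2 (inputMeasure ρ))
    (hW : IsEigendecomposition (gradMatrix ρ f) W lam) (hW' : IsPerturbation W W' ε) :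
    ∫ x, ‖coordZ W' (gradient f x)‖ ^ 2 ∂(inputMeasure ρ) ≤
      (ε * √(∑ i : Fin n, lam (Fin.castAdd l i)) + √(∑ j : Fin l, lam (Fin.natAdd n j))) ^ 2 := by
  have hlam := eigenvalue_nonneg hg hW
  have hε := hW'.pos.le
  set A := ∑ i : Fin n, lam (Fin.castAdd l i) with hA
  set B := ∑ j : Fin l, lam (Fin.natAdd n j) with hB
  have hA0 : 0 ≤ A := Finset.sum_nonneg fun i _ => hlam _
  have hB0 : 0 ≤ B := Finset.sum_nonneg fun i _ => hlam _
  have h1 : ∀ i : Fin n,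
      ‖coordZ W' (WithLp.toLp 2 (W.col (Fin.castAdd l i)))‖ ^ 2 ≤ ε ^ 2 := fun i => by
    -- Subtracting the perturbed column costs nothing, since `coordZ W'` annihilates the head
    -- columns of `W'`.
    have h2 : coordZ W' (WithLp.toLp 2 (W.col (Fin.castAdd l i))) =
        coordZ W' (WithLp.toLp 2 (W.col (Fin.castAdd l i) - W'.col (Fin.castAdd l i))) := by
      have h3 := coordZ_col_castAdd hW'.orthogonal i
      unfold coordZ at h3 ⊢
      rw [WithLp.toLp_sub, map_sub, h3, sub_zero]
    rw [h2]
    gcongr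
    exact (norm_coordZ_le hW'.orthogonal _).trans (hW'.norm_col_sub_le _)
  have h2 : ∀ j : Fin l,
      ‖coordZ W' (WithLp.toLp 2 (W.col (Fin.natAdd n j)))‖ ^ 2 ≤ 1 := fun j =>
    pow_le_one₀ (norm_nonneg _)
      ((norm_coordZ_le hW'.orthogonal _).trans_eq (norm_toLp_col hW.orthogonal _))
  calc ∫ x, ‖coordZ W' (gradient f x)‖ ^ 2 ∂(inputMeasure ρ)
      ≤ ε ^ 2 * A + B := by
        rw [integral_norm_sq_coordZ_gradient hg hW, Fin.sum_univ_add]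
        refine add_le_add ?_ ?_
        · rw [hA, Finset.mul_sum]
          refine Finset.sum_le_sum fun i _ => ?_
          rw [mul_comm (ε ^ 2)]
          exact mul_le_mul_of_nonneg_left (h1 i) (hlam _)
        · refine Finset.sum_le_sum fun j _ => ?_
          exact mul_le_of_le_one_right (hlam _) (h2 j)
    _ = (ε * √A) ^ 2 + √B ^ 2 := by rw [mul_pow, Real.sq_sqrt hA0, Real.sq_sqrt hB0]
    -- The square of the sum only adds a nonnegative cross term; the sharper bound ε²A + B is given
    -- up here.
    _ ≤ (ε * √A + √B) ^ 2 := by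
        have : 0 ≤ ε * √A * √B := by positivity
        linarith [add_sq (ε * √A) √B]

lemma lintegral_norm_sq_coordZ_gradient_le
    (hg : MemLp (fun x => gradient f x) 2 (inputMeasure ρ))
    (hW : IsEigendecomposition (gradMatrix ρ f) W lam) (hW' : IsPerturbation W W' ε) :
    ∫⁻ x, ‖coordZ W' (gradient f x)‖ₑ ^ 2 ∂(inputMeasure ρ) ≤
      ENNReal.ofReal ((ε * √(∑ i : Fin n, lam (Fin.castAdd l i)) +
        √(∑ j : Fin l, lam (Fin.natAdd n j))) ^ 2) := by
  have hmem : MemLp (fun x => coordZ W' (gradient f x)) 2 (inputMeasure ρ) :=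
    hg.mono (measurable_coordZ.comp (measurable_gradient f)).aestronglyMeasurable
      (Filter.Eventually.of_forall fun x => norm_coordZ_le hW'.orthogonal _)
  have hint : Integrable (fun x => ‖coordZ W' (gradient f x)‖ ^ 2) (inputMeasure ρ) :=
    hmem.integrable_norm_pow two_ne_zero
  refine le_trans (le_of_eq ?_)
    (ENNReal.ofReal_le_ofReal (integral_norm_sq_coordZ_gradient_le hg hW hW'))
  rw [ofReal_integral_eq_lintegral_ofReal hint
    (Filter.Eventually.of_forall fun x => sq_nonneg _)]
  refine lintegral_congr fun x => ?_
  rw [ENNReal.ofReal_pow (norm_nonneg _), ofReal_norm]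

end TailBound

/-! ### Bias–variance decomposition and the response surface. -/

section ResponseSurface

lemma lintegral_sq_sub_const {α : Type*} [MeasurableSpace α] {μ : Measure α}
    [IsProbabilityMeasure μ] {u : α → ℝ} (hu : MemLp u 2 μ) (c : ℝ) :
    ∫⁻ a, ENNReal.ofReal ((u a - c) ^ 2) ∂μ =
      ProbabilityTheory.evariance u μ + ENNReal.ofReal ((∫ a, u a ∂μ - c) ^ 2) := by
  have hc : MemLp (fun a => u a - c) 2 μ := hu.sub (memLp_const c)
  have h := ProbabilityTheory.variance_eq_sub hc
  rw [ProbabilityTheory.variance_sub_const hu.aestronglyMeasurable,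
    integral_sub (hu.integrable one_le_two) (integrable_const c), integral_const, probReal_univ,
    one_smul] at h
  rw [← ProbabilityTheory.ofReal_variance hu,
    ← ENNReal.ofReal_add (ProbabilityTheory.variance_nonneg _ _) (sq_nonneg _), h,
    sub_add_cancel]
  exact (ofReal_integral_eq_lintegral_ofReal hc.integrable_sq
      (Filter.Eventually.of_forall fun a => sq_nonneg _)).symm

variable {n l : ℕ} {W : Matrix (Fin (n + l)) (Fin (n + l)) ℝ} {ρ f : 𝔼 (n + l) → ℝ} {N P : ℕ}
  {design : Fin P → 𝔼 n} {R : 𝔼 n → (Fin P → ℝ) → ℝ}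

/-- The estimate is unbiased, so its second moment about c is its variance plus the left side, and
the variance is dropped. Only the marginal law of each draw matters, and N > 0 makes the average
meaningful. -/
lemma ofReal_sq_integral_sub_le_lintegral_mcEstimate (hN : 0 < N) {y : 𝔼 n}
    [IsProbabilityMeasure (condZ ρ W y)]
    (hu : MemLp (fun z => f (combine W y z)) 2 (condZ ρ W y)) (c : ℝ) :
    ENNReal.ofReal ((∫ z, f (combine W y z) ∂(condZ ρ W y) - c) ^ 2) ≤
      ∫⁻ ζ, ENNReal.ofReal ((mcEstimate f W y ζ - c) ^ 2) ∂(sampleLaw ρ W N y) := by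
  have hprob : IsProbabilityMeasure (sampleLaw ρ W N y) := by unfold sampleLaw; infer_instance
  have heval : ∀ i : Fin N, MeasurePreserving (Function.eval i) (sampleLaw ρ W N y)
      (condZ ρ W y) := fun i => measurePreserving_eval (fun _ : Fin N => condZ ρ W y) i
  have hi : ∀ i : Fin N, MemLp (fun ζ : Fin N → 𝔼 l => f (combine W y (ζ i))) 2
      (sampleLaw ρ W N y) := fun i => hu.comp_measurePreserving (heval i)
  have hmc : MemLp (fun ζ : Fin N → 𝔼 l => mcEstimate f W y ζ) 2 (sampleLaw ρ W N y) :=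
    (memLp_finsetSum _ fun i _ => hi i).const_mul _
  have hmean : ∫ ζ : Fin N → 𝔼 l, mcEstimate f W y ζ ∂(sampleLaw ρ W N y) =
      ∫ z, f (combine W y z) ∂(condZ ρ W y) := by
    have hint : ∀ i : Fin N, ∫ ζ : Fin N → 𝔼 l, f (combine W y (ζ i)) ∂(sampleLaw ρ W N y) =
        ∫ z, f (combine W y z) ∂(condZ ρ W y) := fun i => by
      have h := (heval i).map_eq
      have hm := hu.aestronglyMeasurable
      rw [← h] at hm
      conv_rhs => rw [← h]
      rw [integral_map (heval i).measurable.aemeasurable hm]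
    simp only [mcEstimate]
    rw [integral_const_mul, integral_finsetSum _ fun i _ => (hi i).integrable one_le_two]
    simp only [hint, Finset.sum_const, Finset.card_univ, Fintype.card_fin, nsmul_eq_mul]
    have : (N : ℝ) ≠ 0 := by positivity
    field_simp
  rw [lintegral_sq_sub_const hmc, hmean]
  exact le_add_self

lemma measurable_responseSurface (hf : Measurable f) (hR : Measurable (Function.uncurry R)) :
    Measurable fun p : 𝔼 n × (Fin P → Fin N → 𝔼 l) =>
      responseSurface f W design R p.2 p.1 := by
  refine hR.comp (measurable_fst.prodMk (measurable_pi_lambda _ fun k => ?_))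
  refine measurable_const.mul (Finset.measurable_sum _ fun i _ => ?_)
  have h1 : Measurable fun p : 𝔼 n × (Fin P → Fin N → 𝔼 l) => p.2 k i := by fun_prop
  exact hf.comp ((measurable_combine_left _).comp h1)

lemma isProbabilityMeasure_designLaw
    (hdesign : ∀ k, 0 < marginalY ρ W (design k) ∧ marginalY ρ W (design k) < ⊤) :
    IsProbabilityMeasure (designLaw ρ W N design) := by
  have : ∀ k, IsProbabilityMeasure (condZ ρ W (design k)) := fun k =>
    isProbabilityMeasure_normalizedDensity (hdesign k).1.ne' (hdesign k).2.ne
  unfold designLaw sampleLaw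
  infer_instance

/-- The bias part of the error: the conditional mean of `f` against the response surface. -/
lemma lintegral_bias_le (hW : W ∈ Matrix.orthogonalGroup (Fin (n + l)) ℝ)
    (hρ : Measurable ρ) (hρ1 : ∫⁻ x, ENNReal.ofReal (ρ x) = 1) (hfm : Measurable f)
    (hf2 : MemLp f 2 (inputMeasure ρ)) (hN : 0 < N)
    [IsProbabilityMeasure (designLaw ρ W N design)] {b : ℝ}
    (hbound : ResponseSurfaceBound f ρ W N design R b)
    (hm : Measurable fun y => ∫⁻ d, ENNReal.ofReal ((∫ z, f (combine W y z) ∂(condZ ρ W y) -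
      responseSurface f W design R d y) ^ 2) ∂(designLaw ρ W N design)) :
    ∫⁻ x, ∫⁻ d, ENNReal.ofReal ((∫ z, f (combine W (coordY W x) z) ∂(condZ ρ W (coordY W x)) -
      responseSurface f W design R d (coordY W x)) ^ 2) ∂(designLaw ρ W N design)
      ∂(inputMeasure ρ) ≤ ENNReal.ofReal b := by
  have := isProbabilityMeasure_inputMeasure hρ1
  have hmap : IsProbabilityMeasure ((inputMeasure ρ).map (coordZ W)) :=
    Measure.isProbabilityMeasure_map measurable_coordZ.aemeasurable
  have hgood : ∀ᵐ x ∂(inputMeasure ρ), IsProbabilityMeasure (condZ ρ W (coordY W x)) ∧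
      MemLp (fun z => f (combine W (coordY W x) z)) 2 (condZ ρ W (coordY W x)) :=
    (ae_isProbabilityMeasure_condZ hW hρ hρ1).and (ae_memLp_condZ hW hρ hρ1 hfm hf2)
  have hgood' := ae_condY_of_ae hW hρ hρ1 hgood
  simp only [coordY_combine hW] at hgood'
  -- The integrand depends on x through y alone; averaging over z first and then over y given z
  -- brings it to the form of the assumption.
  rw [← lintegral_lintegral_condY hW hρ hρ1 (h := fun y _ => ∫⁻ d, ENNReal.ofReal
    ((∫ z, f (combine W y z) ∂(condZ ρ W y) - responseSurface f W design R d y) ^ 2)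
      ∂(designLaw ρ W N design)) (hm.comp measurable_fst)]
  calc _ ≤ ∫⁻ _z, ENNReal.ofReal b ∂((inputMeasure ρ).map (coordZ W)) := by
        refine lintegral_mono_ae ?_
        filter_upwards [hgood', hbound] with z hz hb
        refine le_trans (lintegral_mono_ae ?_) hb
        filter_upwards [hz] with y hy
        have := hy.1
        exact lintegral_mono fun d =>
          ofReal_sq_integral_sub_le_lintegral_mcEstimate hN hy.2 _
    _ = ENNReal.ofReal b := by simp

/-- Resampling z given y exposes the fibre average. On a fibre with d fixed, the surface is constant
and bias–variance is exact; the variance does not involve d, so averaging over d leaves it alone. -/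
lemma lintegral_error_eq (hW : W ∈ Matrix.orthogonalGroup (Fin (n + l)) ℝ)
    (hρ : Measurable ρ) (hρ1 : ∫⁻ x, ENNReal.ofReal (ρ x) = 1) (hfm : Measurable f)
    (hf2 : MemLp f 2 (inputMeasure ρ)) (hR : Measurable (Function.uncurry R))
    [IsProbabilityMeasure (designLaw ρ W N design)]
    (hm : Measurable fun y => ∫⁻ d, ENNReal.ofReal ((∫ z, f (combine W y z) ∂(condZ ρ W y) -
      responseSurface f W design R d y) ^ 2) ∂(designLaw ρ W N design)) :
    ∫⁻ p, ENNReal.ofReal ((f p.1 - responseSurface f W design R p.2 (coordY W p.1)) ^ 2)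
        ∂((inputMeasure ρ).prod (designLaw ρ W N design)) =
      ∫⁻ x, ProbabilityTheory.evariance (fun z => f (combine W (coordY W x) z))
          (condZ ρ W (coordY W x)) ∂(inputMeasure ρ) +
        ∫⁻ x, ∫⁻ d, ENNReal.ofReal
          ((∫ z, f (combine W (coordY W x) z) ∂(condZ ρ W (coordY W x)) -
            responseSurface f W design R d (coordY W x)) ^ 2) ∂(designLaw ρ W N design)
          ∂(inputMeasure ρ) := by
  have hsurf := measurable_responseSurface (W := W) (N := N) (design := design) hfm hR
  have hjoint : Measurable fun p : 𝔼 (n + l) × (Fin P → Fin N → 𝔼 l) =>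
      ENNReal.ofReal ((f p.1 - responseSurface f W design R p.2 (coordY W p.1)) ^ 2) := by
    have h : Measurable fun p : 𝔼 (n + l) × (Fin P → Fin N → 𝔼 l) => (coordY W p.1, p.2) :=
      (measurable_coordY.comp measurable_fst).prodMk measurable_snd
    exact (((hfm.comp measurable_fst).sub (hsurf.comp h)).pow_const 2).ennreal_ofReal
  have hx : Measurable fun x => ∫⁻ d, ENNReal.ofReal
      ((f x - responseSurface f W design R d (coordY W x)) ^ 2) ∂(designLaw ρ W N design) :=
    hjoint.lintegral_prod_right'
  have hh : Measurable (Function.uncurry fun (y : 𝔼 n) (z : 𝔼 l) => ∫⁻ d, ENNReal.ofReal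
      ((f (combine W y z) - responseSurface f W design R d y) ^ 2)
        ∂(designLaw ρ W N design)) := by
    have h := hx.comp (measurable_combine (W := W))
    simp only [Function.comp_def, coordY_combine hW] at h
    exact h
  have h0 := lintegral_lintegral_condZ hW hρ hρ1 hh
  simp_rw [combine_coord hW] at h0
  have := isProbabilityMeasure_inputMeasure hρ1
  have hmx : Measurable fun x => ∫⁻ d, ENNReal.ofReal
      ((∫ z, f (combine W (coordY W x) z) ∂(condZ ρ W (coordY W x)) -
        responseSurface f W design R d (coordY W x)) ^ 2) ∂(designLaw ρ W N design) :=
    hm.comp measurable_coordY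
  -- Additivity uses only measurability of the bias summand, so measurability of the conditional
  -- variance in x is never needed.
  rw [lintegral_prod _ hjoint.aemeasurable, ← h0, ← lintegral_add_right _ hmx]
  refine lintegral_congr_ae ?_
  filter_upwards [ae_isProbabilityMeasure_condZ hW hρ hρ1, ae_memLp_condZ hW hρ hρ1 hfm hf2]
    with x hprob hu
  have hzd : Measurable (Function.uncurry fun (z : 𝔼 l) (d : Fin P → Fin N → 𝔼 l) =>
      ENNReal.ofReal ((f (combine W (coordY W x) z) -
        responseSurface f W design R d (coordY W x)) ^ 2)) := by
    have h : Measurable fun d : Fin P → Fin N → 𝔼 l =>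
      responseSurface f W design R d (coordY W x) := hsurf.comp measurable_prodMk_left
    exact (((hfm.comp ((measurable_combine_left _).comp measurable_fst)).sub
      (h.comp measurable_snd)).pow_const 2).ennreal_ofReal
  -- Makes z the inner variable, so that the surface is a constant under the inner integral.
  rw [lintegral_lintegral_swap hzd.aemeasurable]
  simp_rw [lintegral_sq_sub_const hu]
  rw [lintegral_add_left measurable_const, lintegral_const, measure_univ, mul_one]

lemma measurable_lintegral_bias (hρ : Measurable ρ) (hfm : Measurable f)
    (hR : Measurable (Function.uncurry R)) [IsProbabilityMeasure (designLaw ρ W N design)] :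
    Measurable fun y => ∫⁻ d, ENNReal.ofReal ((∫ z, f (combine W y z) ∂(condZ ρ W y) -
      responseSurface f W design R d y) ^ 2) ∂(designLaw ρ W N design) := by
  have h : Measurable fun p : 𝔼 n × (Fin P → Fin N → 𝔼 l) => ENNReal.ofReal
      ((∫ z, f (combine W p.1 z) ∂(condZ ρ W p.1) -
        responseSurface f W design R p.2 p.1) ^ 2) :=
    ((((measurable_integral_condZ hρ hfm).comp measurable_fst).sub
      (measurable_responseSurface hfm hR)).pow_const 2).ennreal_ofReal
  exact h.lintegral_prod_right'

end ResponseSurface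

/-! ### Assembly of the error bound. -/

theorem mainTheorem6 {n l : ℕ} (hl : 0 < l)
    (X : Set (𝔼 (n + l))) (ρ : 𝔼 (n + l) → ℝ) (hρ : IsInputDensity X ρ)
    (hC₁ : poincareConst X ρ ≠ ⊤)
    (f : 𝔼 (n + l) → ℝ) (hf : IsAdmissible X (inputMeasure ρ) f)
    (W : Matrix (Fin (n + l)) (Fin (n + l)) ℝ) (lam : Fin (n + l) → ℝ)
    (hW : IsEigendecomposition (gradMatrix ρ f) W lam)
    (W' : Matrix (Fin (n + l)) (Fin (n + l)) ℝ) (ε : ℝ) (hW' : IsPerturbation W W' ε)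
    (N : ℕ) (hN : 0 < N) (P : ℕ)
    (design : Fin P → 𝔼 n)
    (hdesign : ∀ k, 0 < marginalY ρ W' (design k) ∧ marginalY ρ W' (design k) < ⊤)
    (R : 𝔼 n → (Fin P → ℝ) → ℝ) (hR : Measurable (Function.uncurry R))
    (C₂ δ : ℝ) (hC₂ : 0 ≤ C₂) (hδ : 0 ≤ δ)
    (hbound : ResponseSurfaceBound f ρ W' N design R (C₂ * δ)) :
    MeasureTheory.Integrable
        (fun p : 𝔼 (n + l) × (Fin P → Fin N → 𝔼 l) =>
          (f p.1 - responseSurface f W' design R p.2 (coordY W' p.1)) ^ 2)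
        ((inputMeasure ρ).prod (designLaw ρ W' N design)) ∧
      ∫ p : 𝔼 (n + l) × (Fin P → Fin N → 𝔼 l),
          (f p.1 - responseSurface f W' design R p.2 (coordY W' p.1)) ^ 2
          ∂((inputMeasure ρ).prod (designLaw ρ W' N design)) ≤
        (poincareConst X ρ).toReal * (1 + 1 / (N : ℝ)) *
            (ε * √(∑ i : Fin n, lam (Fin.castAdd l i)) +
              √(∑ j : Fin l, lam (Fin.natAdd n j))) ^ 2 +
          C₂ * δ := by
  have hO := hW'.orthogonal
  have hD : IsProbabilityMeasure (designLaw ρ W' N design) :=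
    isProbabilityMeasure_designLaw hdesign
  have hm := measurable_lintegral_bias (W := W') (N := N) (design := design)
    hρ.measurable hf.measurable hR
  set s := (ε * √(∑ i : Fin n, lam (Fin.castAdd l i)) +
    √(∑ j : Fin l, lam (Fin.natAdd n j))) ^ 2 with hs
  have hs0 : 0 ≤ s := sq_nonneg _
  have hb : 0 ≤ C₂ * δ := mul_nonneg hC₂ hδ
  have hc : 0 ≤ (poincareConst X ρ).toReal := ENNReal.toReal_nonneg
  -- Working with extended nonnegative integrals gives the bound before integrability is known; its
  -- finiteness then supplies integrability.
  have htotal : ∫⁻ p, ENNReal.ofReal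
      ((f p.1 - responseSurface f W' design R p.2 (coordY W' p.1)) ^ 2)
        ∂((inputMeasure ρ).prod (designLaw ρ W' N design)) ≤
      ENNReal.ofReal ((poincareConst X ρ).toReal * s + C₂ * δ) := by
    rw [lintegral_error_eq hO hρ.measurable hρ.mass_one hf.measurable hf.sq_integrable hR hm,
      ENNReal.ofReal_add (mul_nonneg hc hs0) hb, ENNReal.ofReal_mul hc, ENNReal.ofReal_toReal hC₁]
    refine add_le_add ?_ (lintegral_bias_le hO hρ.measurable hρ.mass_one hf.measurable
      hf.sq_integrable hN hbound hm)
    refine (lintegral_evariance_condZ_le hO hρ.measurable hρ.mass_one hC₁ hf).trans ?_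
    gcongr
    exact lintegral_norm_sq_coordZ_gradient_le hf.grad_sq_integrable hW hW'
  have hmeas : Measurable fun p : 𝔼 (n + l) × (Fin P → Fin N → 𝔼 l) =>
      (f p.1 - responseSurface f W' design R p.2 (coordY W' p.1)) ^ 2 := by
    have h : Measurable fun p : 𝔼 (n + l) × (Fin P → Fin N → 𝔼 l) => (coordY W' p.1, p.2) :=
      (measurable_coordY.comp measurable_fst).prodMk measurable_snd
    exact ((hf.measurable.comp measurable_fst).sub
      ((measurable_responseSurface hf.measurable hR).comp h)).pow_const 2
  have hnonneg : 0 ≤ᵐ[(inputMeasure ρ).prod (designLaw ρ W' N design)]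
      fun p : 𝔼 (n + l) × (Fin P → Fin N → 𝔼 l) =>
        (f p.1 - responseSurface f W' design R p.2 (coordY W' p.1)) ^ 2 :=
    Filter.Eventually.of_forall fun p => sq_nonneg _
  refine ⟨⟨hmeas.aestronglyMeasurable, ?_⟩, ?_⟩
  · rw [hasFiniteIntegral_iff_ofReal hnonneg]
    exact htotal.trans_lt ENNReal.ofReal_lt_top
  · rw [integral_eq_lintegral_of_nonneg_ae hnonneg hmeas.aestronglyMeasurable]
    refine (ENNReal.toReal_le_of_le_ofReal (by positivity) htotal).trans ?_
    -- The bound in `htotal` has no Monte Carlo factor; 1 + 1/N ≥ 1 enters only as a weakening.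
    have hfactor : (poincareConst X ρ).toReal * s ≤
        (poincareConst X ρ).toReal * (1 + 1 / (N : ℝ)) * s := by
      refine mul_le_mul_of_nonneg_right (le_mul_of_one_le_right hc ?_) hs0
      exact le_add_of_nonneg_right (by positivity)
    linarith
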